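/- Let $G$ be a connected finite simple graph with $n\ge 2$ vertices $v_1,\dots,v_n$, and let $\overrightarrow{H}=(H_1,\dots,H_n)$ be an $n$-tuple of simple graphs, all with the same number $k\ge 1$ of vertices. The vertex complemented corona $G\tilde\circ\overrightarrow{H}$ is the graph obtained from the disjoint union of $G,H_1,\dots,H_n$ by joining, for each $i=1,\dots,n$, every vertex of $H_i$ to every vertex of $V(G)\setminus\{v_i\}$. A finite simple graph $X$ with Laplacian matrix $L_X=D_X-A_X$ (degree matrix minus adjacency matrix) is said to have Laplacian perfect state transfer from a vertex $u$ to a vertex $v\neq u$ at time $\tau\in\mathbb{R}$ if $\left|\exp(-\mathrm{i}\tau L_X)_{u,v}\right|=1$. Then $G\tilde\circ\overrightarrow{H}$ has no Laplacian perfect state transfer from any vertex to any other vertex at any time $\tau\in\mathbb{R}$. -/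

import Mathlib

/-- The adjacency relation of the vertex complemented corona of `G` and the family `H`, on the
disjoint union of the vertices of `G` and the vertices of all the graphs `H v`: the graph `G` and
the graphs `H v` keep their edges, no edge joins `H u` to `H v` for `u ≠ v`, and every vertex of
`H v` is joined to every vertex of `G` except `v`. -/
def vertexComplementedCoronaAdj {V : Type*} {W : V → Type*} (G : SimpleGraph V)
    (H : (v : V) → SimpleGraph (W v)) : V ⊕ (Σ v, W v) → V ⊕ (Σ v, W v) → Prop
  | .inl u, .inl v => G.Adj u v
  | .inl u, .inr b => u ≠ b.1
  | .inr a, .inl v => a.1 ≠ v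
  | .inr a, .inr b => ∃ h : a.1 = b.1, (H b.1).Adj (h ▸ a.2) b.2

/-- The vertex complemented corona of a graph `G` and a family of graphs `H v`, one for each
vertex `v` of `G`. -/
def vertexComplementedCorona {V : Type*} {W : V → Type*} (G : SimpleGraph V)
    (H : (v : V) → SimpleGraph (W v)) : SimpleGraph (V ⊕ (Σ v, W v)) where
  Adj := vertexComplementedCoronaAdj G H
  symm := ⟨by
    rintro (u | ⟨u, x⟩) (v | ⟨v, y⟩) h
    · exact SimpleGraph.Adj.symm (G := G) h
    · exact Ne.symm h
    · exact Ne.symm h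
    · obtain ⟨h, hxy⟩ := h
      dsimp only at h
      subst h
      exact ⟨rfl, hxy.symm⟩⟩
  loopless := ⟨by
    rintro (u | ⟨u, x⟩) h
    · exact G.irrefl h
    · obtain ⟨_, hxx⟩ := h
      exact (H u).irrefl hxx⟩

open Classical in
/-- The Laplacian transition matrix `exp (-i t L)` of a finite graph, where `L` is its Laplacian
matrix (degree matrix minus adjacency matrix). -/
noncomputable def laplacianTransitionMatrix {V : Type*} [Fintype V] (G : SimpleGraph V) (t : ℝ) :
    Matrix V V ℂ :=
  NormedSpace.exp ((-Complex.I * (t : ℂ)) • G.lapMatrix ℂ)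

/-- `G` has Laplacian perfect state transfer from `u` to `v` at time `τ`. -/
def HasLaplacianPSTAt {V : Type*} [Fintype V] (G : SimpleGraph V) (u v : V) (τ : ℝ) : Prop :=
  u ≠ v ∧ ‖laplacianTransitionMatrix G τ u v‖ = 1

/-!
Perfect state transfer from `u` at time `τ` forces `exp (-2 i τ θ) = 1` for every Laplacian
eigenvalue `θ` in the support of `u`, that is, having an eigenvector that does not vanish at `u`:
the transition matrix is symmetric and unitary and fixes the constant vector, so it swaps the
coordinates of an eigenvector at the two vertices up to the phase of its eigenvalue
(`HasLaplacianPSTAt.exists_int_mul_pi`). Hence any two nonzero eigenvalues in the support have a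
rational ratio. If one of them is an integer, all of them are rational, and so integers, since the
characteristic polynomial is monic with integer coefficients
(`HasLaplacianPSTAt.exists_int_eigenvalue`).

In the corona, with `n` vertices in `G` and `k` in each `H v`, the vector equal to `-k` on `G` and
to `1` on all `H v` is an eigenvector for the integer `(k + 1) (n - 1) ≠ 0`, and it vanishes
nowhere. On the other hand an eigenvector `x` of `G` for an eigenvalue `l > 0` lifts to two
eigenvectors of the corona, equal to `a x` on `G` and to `x v` on `H v`, for the eigenvalues
`a + n - 1`, where `a` runs through the roots of `a ^ 2 - s a - k` with `s = l + (k - 1) (n - 1)`.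
As `G` is connected with at least two vertices, `x` can be chosen so that both lifts are nonzero at
any given vertex. Perfect state transfer would then make both roots integers. Their sum `s` would
be an integer, hence so would `l`, and `s ≥ k`. But integers with product `-k < 0` have sum less
than `k`.
-/

/-! ### Matrix exponentials and rational eigenvalues -/

open Matrix

/-- An eigenvector of `A` for `θ` is an eigenvector of `exp A` for `exp θ`. -/
theorem Matrix.exp_mulVec_of_mulVec_eq_smul {V : Type*} [Fintype V] [DecidableEq V]
    {A : Matrix V V ℂ} {z : V → ℂ} {θ : ℂ} (h : A *ᵥ z = θ • z) :
    NormedSpace.exp A *ᵥ z = Complex.exp θ • z := by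
  -- All columns of `Z` are equal to `z`, so that `Z` intertwines the scalar matrix `θ` and `A`.
  let Z : Matrix V V ℂ := of fun i _ ↦ z i
  have hZ : SemiconjBy Z (diagonal fun _ ↦ θ) A := by
    ext i j
    rw [mul_diagonal, mul_comm]
    exact (congrFun h i).symm
  have hexp : SemiconjBy Z (NormedSpace.exp (diagonal fun _ ↦ θ)) (NormedSpace.exp A) := by
    let _ : NormedRing (Matrix V V ℂ) := Matrix.linftyOpNormedRing
    let _ : NormedAlgebra ℂ (Matrix V V ℂ) := Matrix.linftyOpNormedAlgebra
    let _ : NormedAlgebra ℚ (Matrix V V ℂ) := .restrictScalars ℚ ℂ _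
    exact hZ.exp_right
  rw [exp_diagonal] at hexp
  ext i
  have hi := congrFun (congrFun hexp i) i
  rw [mul_diagonal, Pi.coe_exp, ← Complex.exp_eq_exp_ℂ, mul_comm] at hi
  exact hi.symm

/-- If `A` is skew-Hermitian, each row of `exp A` is a unit vector. -/
theorem Matrix.sum_norm_sq_exp_row {V : Type*} [Fintype V] [DecidableEq V]
    {A : Matrix V V ℂ} (h : Aᴴ = -A) (u : V) :
    ∑ w, ‖NormedSpace.exp A u w‖ ^ 2 = 1 := by
  have h1 : NormedSpace.exp A * (NormedSpace.exp A)ᴴ = 1 := by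
    rw [← exp_conjTranspose, h, ← exp_add_of_commute _ _ (Commute.refl A).neg_right, add_neg_cancel,
      NormedSpace.exp_zero]
  have h2 := congrFun (congrFun h1 u) u
  simp only [mul_apply, conjTranspose_apply, one_apply_eq, Complex.star_def,
    Complex.mul_conj'] at h2
  exact_mod_cast h2

/-- A rational eigenvalue of a matrix with integer entries is an integer. -/
theorem Matrix.exists_int_of_rat_eigenvalue {V : Type*} [Fintype V] [DecidableEq V]
    (A : Matrix V V ℤ) {z : V → ℂ} (hz : z ≠ 0) {q : ℚ}
    (h : A.map (Int.cast : ℤ → ℂ) *ᵥ z = (q : ℂ) • z) : ∃ m : ℤ, (m : ℚ) = q := by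
  have hdet : (A.map (Int.cast : ℤ → ℂ)).charpoly.eval (q : ℂ) = 0 := by
    rw [eval_charpoly]
    refine exists_mulVec_eq_zero_iff.mp ⟨z, hz, ?_⟩
    rw [sub_mulVec, h, scalar_apply, ← smul_one_eq_diagonal, smul_mulVec, one_mulVec, sub_self]
  have hint : IsIntegral ℤ q := by
    refine ⟨A.charpoly, A.charpoly_monic, ?_⟩
    have h2 : A.map (Int.cast : ℤ → ℂ) = (Int.castRingHom ℂ).mapMatrix A := rfl
    rw [h2, RingHom.mapMatrix_apply, charpoly_map, Polynomial.eval_map] at hdet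
    apply (algebraMap ℚ ℂ).injective
    rw [Polynomial.hom_eval₂, map_zero]
    have hcomp : (algebraMap ℚ ℂ).comp (algebraMap ℤ ℚ) = Int.castRingHom ℂ :=
      RingHom.ext_int _ _
    rw [hcomp]
    exact hdet
  obtain ⟨m, hm⟩ := IsIntegrallyClosed.isIntegral_iff.mp hint
  exact ⟨m, by simpa using hm⟩

/-! ### Eigenvectors of the Laplacian matrix -/

namespace SimpleGraph

/-- The Laplacian sums the differences along the edges at a vertex. -/
theorem lapMatrix_mulVec_apply_eq_sum {V R : Type*} [Fintype V] [DecidableEq V] [Ring R]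
    (G : SimpleGraph V) [DecidableRel G.Adj] (z : V → R) (v : V) :
    (G.lapMatrix R *ᵥ z) v = ∑ w, if G.Adj v w then z v - z w else 0 := by
  rw [lapMatrix_mulVec_apply, ← Finset.sum_filter, Finset.sum_sub_distrib, Finset.sum_const,
    nsmul_eq_mul, ← neighborFinset_eq_filter, card_neighborFinset_eq_degree]

/-- Since the Laplacian matrix is symmetric and kills constants, an eigenvector for a nonzero
eigenvalue has coordinate sum zero. -/
theorem sum_eq_zero_of_lapMatrix_mulVec {V : Type*} [Fintype V] [DecidableEq V]
    (G : SimpleGraph V) [DecidableRel G.Adj] {x : V → ℝ} {l : ℝ}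
    (hx : G.lapMatrix ℝ *ᵥ x = l • x) (hl : l ≠ 0) : ∑ v, x v = 0 := by
  have h : (fun _ ↦ (1 : ℝ)) ⬝ᵥ (G.lapMatrix ℝ *ᵥ x) = 0 := by
    rw [dotProduct_mulVec, ← mulVec_transpose, (G.isSymm_lapMatrix (R := ℝ)).eq,
      lapMatrix_mulVec_const_eq_zero, zero_dotProduct]
  rw [hx, dotProduct_smul, smul_eq_mul] at h
  simpa [dotProduct] using (mul_eq_zero.mp h).resolve_left hl

/-- A vertex with a neighbor lies in the support of an eigenvector of the Laplacian matrix for a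
positive eigenvalue: otherwise the diagonal entry at the vertex, its degree, would vanish. -/
theorem exists_lapMatrix_eigenvector_pos {V : Type*} [Fintype V] [DecidableEq V]
    (G : SimpleGraph V) [DecidableRel G.Adj] {v : V} (hv : 0 < G.degree v) :
    ∃ (l : ℝ) (x : V → ℝ), 0 < l ∧ x v ≠ 0 ∧ G.lapMatrix ℝ *ᵥ x = l • x := by
  have hP := G.posSemidef_lapMatrix ℝ
  have hL := hP.isHermitian
  by_contra! hcon
  have key : ∀ i, hL.eigenvalues i = 0 ∨ hL.eigenvectorBasis i v = 0 := by
    intro i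
    by_contra! hi
    exact hcon _ _ (lt_of_le_of_ne (hP.eigenvalues_nonneg i) hi.1.symm) hi.2
      (hL.mulVec_eigenvectorBasis i)
  have hvv : G.lapMatrix ℝ v v = 0 := by
    rw [hL.spectral_theorem, Unitary.conjStarAlgAut_apply, mul_apply]
    refine Finset.sum_eq_zero fun i _ ↦ ?_
    rw [mul_diagonal, IsHermitian.eigenvectorUnitary_apply]
    rcases key i with h | h <;> simp [h]
  simp [lapMatrix, degMatrix] at hvv
  omega

end SimpleGraph

/-! ### Integrality of the eigenvalues under perfect state transfer -/

theorem laplacianTransitionMatrix_zero_apply_of_ne {V : Type*} [Fintype V] (G : SimpleGraph V)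
    {u v : V} (h : u ≠ v) : laplacianTransitionMatrix G 0 u v = 0 := by
  classical
  rw [laplacianTransitionMatrix, Complex.ofReal_zero, mul_zero, zero_smul, NormedSpace.exp_zero,
    one_apply_ne h]

/-- Perfect state transfer from `u` forces the phases at the eigenvalues in the support of `u` to
be `±1`, so that `τ θ` is a multiple of `π` for each of these eigenvalues. -/
theorem HasLaplacianPSTAt.exists_int_mul_pi {V : Type*} [Fintype V] [DecidableEq V]
    {G : SimpleGraph V} [DecidableRel G.Adj] {u v : V} {τ : ℝ} (h : HasLaplacianPSTAt G u v τ)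
    {θ : ℝ} {z : V → ℂ} (hz : G.lapMatrix ℂ *ᵥ z = (θ : ℂ) • z) (hu : z u ≠ 0) :
    ∃ m : ℤ, τ * θ = m * Real.pi := by
  set A : Matrix V V ℂ := (-Complex.I * (τ : ℂ)) • G.lapMatrix ℂ with hA
  have hPST : ‖NormedSpace.exp A u v‖ = 1 := by
    rw [hA, ← h.2, laplacianTransitionMatrix]
    congr!
  have hskew : Aᴴ = -A := by
    rw [hA, conjTranspose_smul, (G.isHermitian_lapMatrix ℂ).eq, ← neg_smul]
    simp
  have hsymm : (NormedSpace.exp A).IsSymm := ((G.isSymm_lapMatrix (R := ℂ)).smul _).exp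
  -- A unit vector with an entry of modulus one vanishes elsewhere.
  have single : ∀ {a b : V}, ‖NormedSpace.exp A a b‖ = 1 → ∀ y : V → ℂ,
      (NormedSpace.exp A *ᵥ y) a = NormedSpace.exp A a b * y b := by
    intro a b hab y
    have hsum := sum_norm_sq_exp_row hskew a
    rw [← Finset.add_sum_erase _ _ (Finset.mem_univ b), hab, one_pow, add_eq_left,
      Finset.sum_eq_zero_iff_of_nonneg fun _ _ ↦ by positivity] at hsum
    rw [mulVec, dotProduct, Finset.sum_eq_single b _ (by simp)]
    intro w _ hw
    have := hsum w (by simp [hw])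
    rw [norm_eq_zero.mp (pow_eq_zero_iff two_ne_zero |>.mp this), zero_mul]
  -- The constant eigenvector shows that the entry of modulus one is equal to one.
  have hone : NormedSpace.exp A u v = 1 := by
    have h0 : A *ᵥ (fun _ ↦ 1) = (0 : ℂ) • (fun _ ↦ 1) := by
      rw [hA, smul_mulVec, G.lapMatrix_mulVec_const_eq_zero, smul_zero, zero_smul]
    have := congrFun (exp_mulVec_of_mulVec_eq_smul h0) u
    rw [single hPST] at this
    simpa using this
  have hone' : NormedSpace.exp A v u = 1 := by rw [← hone, hsymm.apply]
  have hAz : A *ᵥ z = (-Complex.I * τ * θ) • z := by rw [hA, smul_mulVec, hz, smul_smul]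
  have hexp := exp_mulVec_of_mulVec_eq_smul hAz
  have huv := congrFun hexp u
  have hvu := congrFun hexp v
  rw [single hPST, hone, one_mul, Pi.smul_apply, smul_eq_mul] at huv
  rw [single (by rw [hone', norm_one]), hone', one_mul, Pi.smul_apply, smul_eq_mul, huv,
    ← mul_assoc, ← Complex.exp_add, eq_comm, mul_eq_right₀ hu, Complex.exp_eq_one_iff] at hvu
  obtain ⟨m, hm⟩ := hvu
  refine ⟨-m, ?_⟩
  have hc : ((τ * θ : ℝ) : ℂ) = ((-m : ℤ) * Real.pi : ℝ) := by
    apply mul_left_cancel₀ (mul_ne_zero two_ne_zero Complex.I_ne_zero)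
    push_cast
    linear_combination -hm
  exact_mod_cast hc

/-- Under perfect state transfer from `u`, a nonzero integer eigenvalue in the support of `u`
makes all eigenvalues in the support rational, hence integers. -/
theorem HasLaplacianPSTAt.exists_int_eigenvalue {V : Type*} [Fintype V] [DecidableEq V]
    {G : SimpleGraph V} [DecidableRel G.Adj] {u v : V} {τ : ℝ} (h : HasLaplacianPSTAt G u v τ)
    {N : ℤ} (hN : N ≠ 0) {y : V → ℂ} (hy : G.lapMatrix ℂ *ᵥ y = (N : ℂ) • y) (hyu : y u ≠ 0)
    {θ : ℝ} {z : V → ℂ} (hz : G.lapMatrix ℂ *ᵥ z = (θ : ℂ) • z) (hzu : z u ≠ 0) :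
    ∃ m : ℤ, (m : ℝ) = θ := by
  have hτ : τ ≠ 0 := by
    rintro rfl
    have := h.2
    rw [laplacianTransitionMatrix_zero_apply_of_ne G h.1, norm_zero] at this
    exact zero_ne_one this
  obtain ⟨a, ha⟩ := h.exists_int_mul_pi hz hzu
  obtain ⟨b, hb⟩ := h.exists_int_mul_pi (θ := N) (by simpa using hy) hyu
  have hNr : (N : ℝ) ≠ 0 := by exact_mod_cast hN
  have hb0 : (b : ℝ) ≠ 0 := by
    intro h0
    rw [h0, zero_mul] at hb
    exact mul_ne_zero hτ hNr hb
  have hq : ((N * a / b : ℚ) : ℝ) = θ := by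
    push_cast
    rw [div_eq_iff hb0]
    apply mul_left_cancel₀ (mul_ne_zero hτ Real.pi_ne_zero)
    linear_combination (a * Real.pi) * hb - (b * Real.pi) * ha
  have hmap : (G.lapMatrix ℤ).map (Int.cast : ℤ → ℂ) = G.lapMatrix ℂ := by
    ext i j
    simp only [SimpleGraph.lapMatrix, SimpleGraph.degMatrix, map_apply, Matrix.sub_apply, diagonal_apply,
      SimpleGraph.adjMatrix_apply]
    split_ifs <;> simp
  obtain ⟨m, hm⟩ := exists_int_of_rat_eigenvalue (G.lapMatrix ℤ) (z := z) (q := N * a / b)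
    (fun h0 ↦ hzu (congrFun h0 u)) (by rw [hmap, hz, ← hq]; push_cast; rfl)
  exact ⟨m, by rw [← hq, ← hm]; simp⟩

/-! ### Eigenvectors of the vertex complemented corona -/

/-- On vectors that are constant on each `H v`, the Laplacian matrix of the corona depends on the
graphs `H v` only through their number of vertices. -/
theorem lapMatrix_vertexComplementedCorona_mulVec {V : Type*} [Fintype V] [DecidableEq V]
    {W : V → Type*} [∀ v, Fintype (W v)] [DecidableEq (V ⊕ (Σ v, W v))]
    (G : SimpleGraph V) [DecidableRel G.Adj] (H : (v : V) → SimpleGraph (W v))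
    [DecidableRel (vertexComplementedCorona G H).Adj] {k : ℕ}
    (hW : ∀ v, Fintype.card (W v) = k) (f g : V → ℝ) :
    (vertexComplementedCorona G H).lapMatrix ℂ *ᵥ
        Sum.elim (fun v ↦ (f v : ℂ)) (fun b ↦ (g b.1 : ℂ)) =
      Sum.elim
        (fun v ↦ ((((G.lapMatrix ℝ *ᵥ f) v +
          k * ((Fintype.card V - 1) * f v + g v - ∑ w, g w)) : ℝ) : ℂ))
        (fun b ↦ ((((Fintype.card V - 1) * g b.1 + f b.1 - ∑ w, f w) : ℝ) : ℂ)) := by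
  have hne : ∀ (v : V) (c : ℝ) (p : V → ℝ), (∑ w, if v ≠ w then c - p w else 0) =
      (Fintype.card V - 1) * c + p v - ∑ w, p w := by
    intro v c p
    have : ∀ w, (if v ≠ w then c - p w else 0) = c - p w - if v = w then c - p w else 0 := by
      intro w
      split_ifs <;> simp_all
    simp only [this, Finset.sum_sub_distrib, Finset.sum_ite_eq, Finset.mem_univ, if_true,
      Finset.sum_const, Finset.card_univ, nsmul_eq_mul]
    ring
  ext a
  rw [SimpleGraph.lapMatrix_mulVec_apply_eq_sum, Fintype.sum_sum_type, Fintype.sum_sigma]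
  rcases a with v | ⟨v, b⟩
  · simp only [Sum.elim_inl, Sum.elim_inr]
    have h1 : ∀ w, (vertexComplementedCorona G H).Adj (.inl v) (.inl w) ↔ G.Adj v w :=
      fun _ ↦ Iff.rfl
    have h2 : ∀ w b, (vertexComplementedCorona G H).Adj (.inl v) (.inr ⟨w, b⟩) ↔ v ≠ w :=
      fun _ _ ↦ Iff.rfl
    simp only [h1, h2, Finset.sum_const, Finset.card_univ, hW, ← hne,
      SimpleGraph.lapMatrix_mulVec_apply_eq_sum, nsmul_eq_mul, Finset.mul_sum]
    push_cast
    simp only [apply_ite (Complex.ofReal), Complex.ofReal_sub, Complex.ofReal_zero]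
  · simp only [Sum.elim_inl, Sum.elim_inr]
    have h1 : ∀ w, (vertexComplementedCorona G H).Adj (.inr ⟨v, b⟩) (.inl w) ↔ v ≠ w :=
      fun _ ↦ Iff.rfl
    rw [add_eq_left.mpr]
    · simp only [h1, ← hne]
      push_cast
      simp only [apply_ite (Complex.ofReal), Complex.ofReal_sub, Complex.ofReal_zero]
    · refine Finset.sum_eq_zero fun w _ ↦ Finset.sum_eq_zero fun c _ ↦ ?_
      split_ifs with hadj
      · obtain ⟨hvw, -⟩ := hadj
        dsimp only at hvw
        rw [hvw, sub_self]
      · rfl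

/-- The eigenvector of the corona built from an eigenvector `x` of `G`: it is `a x` on `G` and
takes the value `x v` on `H v`. Here `a` is either root of a quadratic. -/
theorem lapMatrix_vertexComplementedCorona_mulVec_lift {V : Type*} [Fintype V] [DecidableEq V]
    {W : V → Type*} [∀ v, Fintype (W v)] [DecidableEq (V ⊕ (Σ v, W v))]
    (G : SimpleGraph V) [DecidableRel G.Adj] (H : (v : V) → SimpleGraph (W v))
    [DecidableRel (vertexComplementedCorona G H).Adj] {k : ℕ}
    (hW : ∀ v, Fintype.card (W v) = k) {x : V → ℝ} {l : ℝ} (hx : G.lapMatrix ℝ *ᵥ x = l • x)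
    (hl : l ≠ 0) {a : ℝ} (ha : a ^ 2 - (l + (k - 1) * (Fintype.card V - 1)) * a - k = 0) :
    (vertexComplementedCorona G H).lapMatrix ℂ *ᵥ
        Sum.elim (fun v ↦ ((a * x v : ℝ) : ℂ)) (fun b ↦ (x b.1 : ℂ)) =
      ((a + (Fintype.card V - 1) : ℝ) : ℂ) •
        Sum.elim (fun v ↦ ((a * x v : ℝ) : ℂ)) (fun b ↦ (x b.1 : ℂ)) := by
  have hsum := G.sum_eq_zero_of_lapMatrix_mulVec hx hl
  rw [lapMatrix_vertexComplementedCorona_mulVec G H hW (fun v ↦ a * x v) x, ← Finset.mul_sum, hsum]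
  have hax : G.lapMatrix ℝ *ᵥ (fun v ↦ a * x v) = a • l • x := by
    rw [← hx, ← mulVec_smul]
    rfl
  ext (v | b)
  · simp only [Sum.elim_inl, Pi.smul_apply, smul_eq_mul, hax, ← Complex.ofReal_mul]
    congr 1
    linear_combination -x v * ha
  · simp only [Sum.elim_inr, Pi.smul_apply, smul_eq_mul, ← Complex.ofReal_mul]
    congr 1
    ring

/-- A nowhere vanishing eigenvector of the corona, for an integer eigenvalue that is nonzero as soon
as `G` has at least two vertices. -/
theorem lapMatrix_vertexComplementedCorona_mulVec_const {V : Type*} [Fintype V] [DecidableEq V]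
    {W : V → Type*} [∀ v, Fintype (W v)] [DecidableEq (V ⊕ (Σ v, W v))]
    (G : SimpleGraph V) (H : (v : V) → SimpleGraph (W v))
    [DecidableRel (vertexComplementedCorona G H).Adj] {k : ℕ}
    (hW : ∀ v, Fintype.card (W v) = k) :
    (vertexComplementedCorona G H).lapMatrix ℂ *ᵥ
        Sum.elim (fun _ ↦ ((-k : ℝ) : ℂ)) (fun _ ↦ ((1 : ℝ) : ℂ)) =
      (((k + 1) * (Fintype.card V - 1) : ℤ) : ℂ) •
        Sum.elim (fun _ ↦ ((-k : ℝ) : ℂ)) (fun _ ↦ ((1 : ℝ) : ℂ)) := by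
  classical
  rw [lapMatrix_vertexComplementedCorona_mulVec G H hW (fun _ ↦ -k) (fun _ ↦ 1)]
  ext (v | b)
  · simp [SimpleGraph.lapMatrix_mulVec_apply_eq_sum]
    ring
  · simp
    ring

/-! ### Absence of perfect state transfer -/

/-- For integers `s ≥ k > 0`, the roots of `a ^ 2 - s * a - k` are not both integers: their product
`-k` would force the positive one to be at most `k` and their sum below `k`. -/
theorem not_add_mul_eq_of_le {p q s k : ℤ} (hk : 0 < k) (hs : k ≤ s) (hadd : p + q = s)
    (hmul : p * q = -k) : False := by
  rcases lt_trichotomy q 0 with hq | hq | hq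
  · nlinarith [mul_nonneg (show (0:ℤ) ≤ -1 - q by omega) (show (0:ℤ) ≤ p by omega)]
  · subst hq
    omega
  · have hp : p < 0 := by
      by_contra hp
      nlinarith [mul_nonneg (not_lt.mp hp) hq.le]
    nlinarith [mul_nonneg (show (0:ℤ) ≤ -1 - p by omega) (show (0:ℤ) ≤ q by omega)]

theorem theorem4p2 {V : Type*} [Fintype V] {W : V → Type*} [∀ v, Fintype (W v)]
    (G : SimpleGraph V) (H : (v : V) → SimpleGraph (W v)) (n k : ℕ)
    (hn : Fintype.card V = n) (hn2 : 2 ≤ n) (hG : G.Connected)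
    (hk : 1 ≤ k) (hW : ∀ v, Fintype.card (W v) = k) :
    ¬ ∃ (u v : V ⊕ (Σ v, W v)) (τ : ℝ), HasLaplacianPSTAt (vertexComplementedCorona G H) u v τ := by
  classical
  rintro ⟨u, v, τ, h⟩
  have hN : ((k + 1) * (Fintype.card V - 1) : ℤ) ≠ 0 := by
    rw [hn]
    exact mul_ne_zero (by omega) (by omega)
  have hkr : (0 : ℝ) < k := by exact_mod_cast hk
  -- The vertex of `G` that is `u`, or whose graph contains `u`.
  let r : V := Sum.elim id Sigma.fst u
  have : Nontrivial V := Fintype.one_lt_card_iff_nontrivial.mp (by omega)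
  obtain ⟨l, x, hl, hxr, hx⟩ := G.exists_lapMatrix_eigenvector_pos (v := r)
    (hG.preconnected.degree_pos_of_nontrivial r)
  set s : ℝ := l + (k - 1) * (Fintype.card V - 1) with hs
  have hroot : ∀ a : ℝ, a ^ 2 - s * a - k = 0 → ∃ p : ℤ, (p : ℝ) = a := by
    intro a ha
    have ha0 : a ≠ 0 := by
      rintro rfl
      linarith
    obtain ⟨m, hm⟩ := h.exists_int_eigenvalue hN
      (lapMatrix_vertexComplementedCorona_mulVec_const G H hW)
      (by rcases u with u | u <;> simp; omega)
      (lapMatrix_vertexComplementedCorona_mulVec_lift G H hW hx hl.ne' ha)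
      (by rcases u with u | u
          · exact Complex.ofReal_ne_zero.mpr (mul_ne_zero ha0 hxr)
          · exact Complex.ofReal_ne_zero.mpr hxr)
    exact ⟨m - (Fintype.card V - 1), by push_cast; linarith⟩
  have hdisc : Real.sqrt (s ^ 2 + 4 * k) ^ 2 = s ^ 2 + 4 * k := Real.sq_sqrt (by positivity)
  obtain ⟨p, hp⟩ := hroot ((s + Real.sqrt (s ^ 2 + 4 * k)) / 2) (by linear_combination hdisc / 4)
  obtain ⟨q, hq⟩ := hroot ((s - Real.sqrt (s ^ 2 + 4 * k)) / 2) (by linear_combination hdisc / 4)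
  have hadd : ((p + q : ℤ) : ℝ) = s := by
    push_cast
    rw [hp, hq]
    ring
  have hmul : p * q = -k := by
    have : (p : ℝ) * q = -k := by
      rw [hp, hq]
      linear_combination -hdisc / 4
    exact_mod_cast this
  refine not_add_mul_eq_of_le (by omega) ?_ rfl hmul
  -- As `s` is an integer, `l = s - (k - 1) (n - 1)` is a positive integer, so that `s ≥ 1 + (k - 1)`.
  have hl1 : 0 < p + q - (k - 1) * (Fintype.card V - 1) := by
    have : (0 : ℝ) < ((p + q : ℤ) : ℝ) - (k - 1) * (Fintype.card V - 1) := by linarith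
    exact_mod_cast this
  have hc : (2 : ℤ) ≤ Fintype.card V := by omega
  nlinarith [mul_nonneg (show (0 : ℤ) ≤ k - 1 by omega)
    (show (0 : ℤ) ≤ Fintype.card V - 2 by omega)]
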